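/- **Theorem B.** Let $Q$ be a quiver, that is, a directed graph with a set $Q_0$ of vertices and a set of arrows (possibly infinite). Define a transfinite sequence of subsets $W_\alpha \subseteq Q_0$ by $W_0=\emptyset$; $W_{\beta+1}$ is the set of all $i \in Q_0$ that are not the source of any arrow whose target is outside $\bigcup_{\gamma\leqslant\beta}W_\gamma$; and $W_\alpha=\bigcup_{\beta<\alpha}W_\beta$ for a limit ordinal $\alpha$. Assume that $Q$ is *right rooted*, that is, $W_\lambda=Q_0$ for some ordinal $\lambda$. Let $\mathcal{M}$ be an abelian category that satisfies AB4 and AB4* (small coproducts and small products exist and are exact) and which has enough projectives and enough injectives. Let $\mathrm{Rep}(Q,\mathcal{M})$ be the abelian category of $\mathcal{M}$-valued representations of $Q$. For a representation $Y$ and a vertex $i$, let $\psi_i^Y \colon Y(i) \to \prod_{a\colon i\to j} Y(j)$ be the morphism whose component at $a$ is $Y(a)$, where the product is over all arrows $a$ with source $i$. For a class $\mathcal{C}$ of objects of an abelian category, $\mathcal{C}^\perp$ is the class of all objects $N$ with $\mathrm{Ext}^1(C,N)=0$ for all $C\in\mathcal{C}$, and ${}^\perp\mathcal{C}$ is the class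 of all objects $N$ with $\mathrm{Ext}^1(N,C)=0$ for all $C\in\mathcal{C}$. A pair $(\mathcal{A},\mathcal{B})$ of classes of objects is a *cotorsion pair* if $\mathcal{A}^\perp=\mathcal{B}$ and $\mathcal{A}={}^\perp\mathcal{B}$. It is *hereditary* if $\mathrm{Ext}^n(A,B)=0$ for all $A\in\mathcal{A}$, $B\in\mathcal{B}$ and $n\geqslant 1$; it is *cogenerated by a set* if there is a set $\mathcal{S}$ of objects with $\mathcal{A}={}^\perp\mathcal{S}$ and $\mathcal{B}=({}^\perp\mathcal{S})^\perp$. If $(\mathcal{A},\mathcal{B})$ is a cotorsion pair in $\mathcal{M}$, then $(\mathrm{Rep}(Q,\mathcal{A}),\Psi(\mathcal{B}))$ is a cotorsion pair in $\mathrm{Rep}(Q,\mathcal{M})$, where $$\mathrm{Rep}(Q,\mathcal{A})=\{X\in\mathrm{Rep}(Q,\mathcal{M}) \mid X(i)\in\mathcal{A} \text{ for all } i\in Q_0\},$$ $$\Psi(\mathcal{B})=\{Y\in\mathrm{Rep}(Q,\mathcal{M}) \mid \psi_i^Y \text{ is an epimorphism and } Y(i),\ \mathrm{Ker}\,\psi_i^Y\in\mathcal{B}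 \text{ for all } i\in Q_0\}.$$ Moreover, if $(\mathcal{A},\mathcal{B})$ is hereditary, then so is $(\mathrm{Rep}(Q,\mathcal{A}),\Psi(\mathcal{B}))$; and if $(\mathcal{A},\mathcal{B})$ is cogenerated by a set, then so is $(\mathrm{Rep}(Q,\mathcal{A}),\Psi(\mathcal{B}))$. -/

import Mathlib

open CategoryTheory Limits

universe v u

namespace CotorsionQuiver

/-! ### Cotorsion pairs in an abelian category -/

section Cotorsion

variable {C : Type u} [Category.{v} C] [Abelian C]

/-- `Ext^n(X, Y) = 0`. The Ext-groups are those of Mathlib. They are formed in the universe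
`max u v`, where they always exist, so that no smallness assumption is needed. -/
def ExtVanishes (X Y : C) (n : ℕ) : Prop :=
  letI : HasExt.{max u v} C := HasExt.standard C
  Subsingleton (Abelian.Ext.{max u v} X Y n)

/-- The class `P^⊥` of all `Y` with `Ext¹(X, Y) = 0` for all `X` in `P`. -/
def rightPerp (P : ObjectProperty C) : ObjectProperty C :=
  fun Y => ∀ X : C, P X → ExtVanishes X Y 1

/-- The class `^⊥P` of all `X` with `Ext¹(X, Y) = 0` for all `Y` in `P`. -/
def leftPerp (P : ObjectProperty C) : ObjectProperty C :=
  fun X => ∀ Y : C, P Y → ExtVanishes X Y 1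

/-- `(A, B)` is a cotorsion pair: `A^⊥ = B` and `A = ^⊥B`. -/
structure IsCotorsionPair (A B : ObjectProperty C) : Prop where
  rightPerp_eq : rightPerp A = B
  eq_leftPerp : A = leftPerp B

/-- Heredity of a pair of classes: `Ext^n(X, Y) = 0` for all `X` in `A`, `Y` in `B`, `n ≥ 1`. -/
def IsHereditary (A B : ObjectProperty C) : Prop :=
  ∀ X Y : C, A X → B Y → ∀ n : ℕ, 1 ≤ n → ExtVanishes X Y n

/-- `(A, B)` is cogenerated by a (small) set `S` of objects: `A = ^⊥S` and `B = (^⊥S)^⊥`. -/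
def IsCogeneratedBySet (A B : ObjectProperty C) : Prop :=
  ∃ S : ObjectProperty C, ObjectProperty.Small.{v} S ∧
    A = leftPerp S ∧ B = rightPerp (leftPerp S)

end Cotorsion

/-! ### Right rooted quivers -/

section Rooted

/-- The transfinite sequence of sets of vertices of a quiver with `W 0 = ∅`, with `W (β + 1)` the
set of all vertices that are not the source of any arrow whose target is outside
`⋃ γ ≤ β, W γ`, and with `W α = ⋃ β < α, W β` for a limit ordinal `α`. -/
def W (Q : Type v) [Quiver.{v} Q] (α : Ordinal.{v}) : Set Q :=
  {i | (∃ β : Ordinal.{v}, ∃ _ : α = Order.succ β,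
          ¬ ∃ (j : Q) (_ : i ⟶ j), ¬ ∃ γ : Ordinal.{v}, ∃ _ : γ ≤ β, j ∈ W Q γ) ∨
       (Order.IsSuccLimit α ∧ ∃ β : Ordinal.{v}, ∃ _ : β < α, i ∈ W Q β)}
termination_by α
decreasing_by
  · subst_vars
    exact Order.lt_succ_of_le ‹_›
  · assumption

variable (Q : Type v) [Quiver.{v} Q]

theorem W_zero : W Q 0 = ∅ := by
  rw [W]
  ext i
  simp only [Set.mem_ofPred_eq, Set.mem_empty_iff_false, iff_false]
  rintro (⟨β, h, -⟩ | ⟨-, β, h, -⟩)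
  · exact absurd h.symm (Order.bot_lt_succ β).ne'
  · exact absurd h not_lt_bot

theorem W_succ (β : Ordinal.{v}) :
    W Q (Order.succ β) = {i | ¬ ∃ (j : Q) (_ : i ⟶ j), j ∉ ⋃ γ ≤ β, W Q γ} := by
  rw [W]
  ext i
  simp only [Set.mem_ofPred_eq, Set.mem_iUnion]
  constructor
  · rintro (⟨β', h, h'⟩ | ⟨h, -⟩)
    · obtain rfl := Order.succ_injective h
      exact h'
    · exact absurd h (Order.not_isSuccLimit_succ β)
  · exact fun h => Or.inl ⟨β, rfl, h⟩

theorem W_limit (α : Ordinal.{v}) (hα : Order.IsSuccLimit α) :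
    W Q α = ⋃ β < α, W Q β := by
  rw [W]
  ext i
  simp only [Set.mem_ofPred_eq, Set.mem_iUnion]
  constructor
  · rintro (⟨β, h, -⟩ | ⟨-, h⟩)
    · subst h
      exact absurd hα (Order.not_isSuccLimit_succ β)
    · exact h
  · exact fun h => Or.inr ⟨hα, h⟩

/-- A quiver is right rooted if the sequence `W` exhausts its vertices. -/
def IsRightRooted : Prop :=
  ∃ l : Ordinal.{v}, W Q l = Set.univ

end Rooted

/-! ### Representations of a quiver -/

section Representations

/-- The category of representations of the quiver `Q` with values in `M`. A functor on the free
category on `Q` is the same as an object of `M` for every vertex and a morphism of `M` for every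
arrow; a natural transformation is the same as a family of morphisms, indexed by the vertices,
that commutes with the morphisms of all arrows. -/
abbrev QuiverRep (Q : Type v) [Quiver.{v} Q] (M : Type u) [Category.{v} M] :=
  Paths Q ⥤ M

variable {Q : Type v} [Quiver.{v} Q] {M : Type u} [Category.{v} M]

namespace QuiverRep

/-- The object `X(i)` at the vertex `i`. -/
abbrev at' (X : QuiverRep Q M) (i : Q) : M :=
  X.obj ((Paths.of Q).obj i)

/-- The morphism `X(a) : X(i) ⟶ X(j)` of the arrow `a : i ⟶ j`. -/
abbrev arrow (X : QuiverRep Q M) {i j : Q} (a : i ⟶ j) : X.at' i ⟶ X.at' j :=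
  X.map ((Paths.of Q).map a)

/-- The canonical morphism `ψ_i : X(i) ⟶ ∏ X(j)`, where the product is over all arrows
`a : i ⟶ j` with source `i`. -/
noncomputable def psi [HasProducts.{v} M] (X : QuiverRep Q M) (i : Q) :
    X.at' i ⟶ ∏ᶜ (fun a : (Σ j : Q, i ⟶ j) => X.at' a.1) :=
  Pi.lift fun a : (Σ j : Q, i ⟶ j) => X.arrow a.2

end QuiverRep

/-- The class `Rep(Q, A)` of all representations `X` with `X(i)` in `A` for all vertices `i`. -/
def RepClass (Q : Type v) [Quiver.{v} Q] (A : ObjectProperty M) :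
    ObjectProperty (QuiverRep Q M) :=
  fun X => ∀ i : Q, A (X.at' i)

/-- The class `Ψ(B)` of all representations `Y` such that, for all vertices `i`, the morphism
`ψ_i` is an epimorphism and `Y(i)` and `Ker ψ_i` are in `B`. -/
def PsiClass (Q : Type v) [Quiver.{v} Q] [Abelian M] [HasProducts.{v} M]
    (B : ObjectProperty M) : ObjectProperty (QuiverRep Q M) :=
  fun Y => ∀ i : Q, Epi (Y.psi i) ∧ B (Y.at' i) ∧ B (kernel (Y.psi i))

end Representations

end CotorsionQuiver

namespace CotorsionQuiver

/-! ### Vanishing of Ext¹ in terms of lifting and splitting -/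

section ExtVanishing

open Abelian

variable {C : Type u} [Category.{v} C] [Abelian C]

/-! Vanishing of Ext¹ is tested by splitting extensions; three constructions then relate the two
classes.

If X is in `RepClass Q A` and Y in `PsiClass Q B`, an extension E of X by Y is split by well-founded
recursion along arrows, with targets before sources. At i, a section E(i) ← X(i) exists because Y(i)
is in B. Its failure to commute with the arrows out of i is a morphism X(i) ⟶ ∏ Y(j). This lifts
through ψ_i, an epimorphism with kernel in B, and the lift corrects the section
(`extVanishes_of_psiClass`).

Conversely, let Y be in the right class of `RepClass Q A`. The left adjoint of evaluation at i,
which preserves monomorphisms by AB4, gives Y(i) in B. Stalk representations at i show that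
morphisms from objects of A lift through ψ_i, so ψ_i is epi with kernel in B
(`psiClass_of_rightPerp`).

The right adjoints G_i of evaluation send B into `PsiClass Q B`, and AB4* turns Ext¹(X, G_i N) = 0
into Ext¹(X(i), N) = 0. This recovers `RepClass Q A` as a left class, and also handles cogeneration
by a set. Heredity is dimension shifting. -/

theorem ExtVanishes.exists_lift {S : ShortComplex C} (hS : S.ShortExact) {X : C}
    (h : ExtVanishes X S.X₁ 1) (f : X ⟶ S.X₃) : ∃ g : X ⟶ S.X₂, g ≫ S.g = f := by
  let : HasExt.{max u v} C := HasExt.standard C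
  have : Subsingleton (Ext.{max u v} X S.X₁ 1) := h
  obtain ⟨x, hx⟩ := Ext.covariant_sequence_exact₃ X hS (Ext.mk₀ f) (zero_add 1)
    (Subsingleton.elim _ _)
  obtain ⟨g, rfl⟩ := (Ext.mk₀_bijective _ _).2 x
  rw [Ext.mk₀_comp_mk₀] at hx
  exact ⟨g, (Ext.mk₀_bijective _ _).1 hx⟩

theorem ExtVanishes.exists_extension {S : ShortComplex C} (hS : S.ShortExact) {Y : C}
    (h : ExtVanishes S.X₃ Y 1) (f : S.X₁ ⟶ Y) : ∃ g : S.X₂ ⟶ Y, S.f ≫ g = f := by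
  let : HasExt.{max u v} C := HasExt.standard C
  have : Subsingleton (Ext.{max u v} S.X₃ Y 1) := h
  obtain ⟨x, hx⟩ := Ext.contravariant_sequence_exact₁ hS Y (Ext.mk₀ f) (add_zero 1)
    (Subsingleton.elim _ _)
  obtain ⟨g, rfl⟩ := (Ext.mk₀_bijective _ _).2 x
  rw [Ext.mk₀_comp_mk₀] at hx
  exact ⟨g, (Ext.mk₀_bijective _ _).1 hx⟩

theorem extVanishes_succ_of_projective (P Y : C) [Projective P] (n : ℕ) :
    ExtVanishes P Y (n + 1) := by
  let : HasExt.{max u v} C := HasExt.standard C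
  exact Ext.subsingleton_of_projective P Y n

/-- Dimension shifting: `Ext^(n+1)(S.X₁, Y) = 0` if `Ext^(n+1)(S.X₂, Y)` and `Ext^(n+2)(S.X₃, Y)`
vanish. -/
theorem ExtVanishes.of_shortExact_left {S : ShortComplex C} (hS : S.ShortExact) {Y : C} {n : ℕ}
    (h₂ : ExtVanishes S.X₂ Y n) (h₃ : ExtVanishes S.X₃ Y (n + 1)) : ExtVanishes S.X₁ Y n := by
  let : HasExt.{max u v} C := HasExt.standard C
  have : Subsingleton (Ext.{max u v} S.X₂ Y n) := h₂
  have : Subsingleton (Ext.{max u v} S.X₃ Y (n + 1)) := h₃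
  refine subsingleton_of_forall_eq 0 fun x => ?_
  obtain ⟨y, rfl⟩ := Ext.contravariant_sequence_exact₁ hS Y x (add_comm 1 n)
    (Subsingleton.elim _ _)
  rw [Subsingleton.elim y 0, Ext.comp_zero]

theorem ExtVanishes.of_shortExact_right {S : ShortComplex C} (hS : S.ShortExact) {Y : C} {n : ℕ}
    (h₁ : ExtVanishes S.X₁ Y n) (h₂ : ExtVanishes S.X₂ Y (n + 1)) :
    ExtVanishes S.X₃ Y (n + 1) := by
  let : HasExt.{max u v} C := HasExt.standard C
  have : Subsingleton (Ext.{max u v} S.X₁ Y n) := h₁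
  have : Subsingleton (Ext.{max u v} S.X₂ Y (n + 1)) := h₂
  refine subsingleton_of_forall_eq 0 fun x => ?_
  obtain ⟨y, rfl⟩ := Ext.contravariant_sequence_exact₃ hS Y x
    (Subsingleton.elim _ _) (add_comm 1 n)
  rw [Subsingleton.elim y 0, Ext.comp_zero]

/-- As Ext¹(S.X₂, Y) = 0, every class is the image of some f : S.X₁ ⟶ Y under the connecting map,
which kills every f that extends to S.X₂. -/
theorem extVanishes_one_of_exists_extension {S : ShortComplex C} (hS : S.ShortExact)
    [Projective S.X₂] {Y : C} (H : ∀ f : S.X₁ ⟶ Y, ∃ g : S.X₂ ⟶ Y, S.f ≫ g = f) :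
    ExtVanishes S.X₃ Y 1 := by
  let : HasExt.{max u v} C := HasExt.standard C
  refine subsingleton_of_forall_eq 0 fun x => ?_
  obtain ⟨y, rfl⟩ := Ext.contravariant_sequence_exact₃ hS Y x
    (Ext.eq_zero_of_projective _) (add_zero 1)
  obtain ⟨f, rfl⟩ := (Ext.mk₀_bijective _ _).2 y
  obtain ⟨g, rfl⟩ := H f
  rw [← Ext.mk₀_comp_mk₀, ← Ext.comp_assoc _ _ _ (add_zero 1) (zero_add 0) (by lia),
    hS.extClass_comp, Ext.zero_comp]

theorem shortExact_kernel {X Y : C} (f : X ⟶ Y) [Epi f] :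
    (ShortComplex.mk (kernel.ι f) f (kernel.condition f)).ShortExact where
  exact := ShortComplex.exact_of_f_is_kernel _ (kernelIsKernel f)

theorem shortExact_pushout {S : ShortComplex C} (hS : S.ShortExact) {Y : C} (f : S.X₁ ⟶ Y) :
    (ShortComplex.mk (pushout.inr S.f f) (pushout.desc S.g 0 (by simp))
      (pushout.inr_desc _ _ _) : ShortComplex C).ShortExact := by
  have := hS.mono_f
  have := hS.epi_g
  have hepi : Epi (pushout.desc S.g (0 : Y ⟶ S.X₃) (by simp) : pushout S.f f ⟶ S.X₃) :=
    epi_of_epi_fac (pushout.inl_desc S.g (0 : Y ⟶ S.X₃) (by simp))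
  refine { exact := ?_, mono_f := inferInstance, epi_g := hepi }
  refine ShortComplex.exact_of_g_is_cokernel _ (CokernelCofork.IsColimit.ofπ _ _
    (fun {Z} k hk => hS.exact.desc (pushout.inl S.f f ≫ k) ?_) ?_ ?_)
  · dsimp at k hk
    rw [pushout.condition_assoc, hk, comp_zero]
  · intro Z k hk
    dsimp at k hk ⊢
    apply pushout.hom_ext
    · rw [pushout.inl_desc_assoc, hS.exact.g_desc]
    · rw [pushout.inr_desc_assoc, zero_comp, hk]
  · intro Z k hk m hm
    rw [← cancel_epi S.g, hS.exact.g_desc, ← hm]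
    exact (pushout.inl_desc_assoc _ _ _ _).symm

variable [EnoughProjectives C]

/-- Push a projective presentation of X out along f : K ⟶ Y. A retraction of the resulting extension
extends f to the projective object. -/
theorem extVanishes_one_of_retraction {X Y : C}
    (H : ∀ {E : C} (i : Y ⟶ E) (p : E ⟶ X) (w : i ≫ p = 0),
      (ShortComplex.mk i p w).ShortExact → ∃ r : E ⟶ Y, i ≫ r = 𝟙 Y) :
    ExtVanishes X Y 1 := by
  have hS := shortExact_kernel (Projective.π X)
  refine extVanishes_one_of_exists_extension hS fun f => ?_
  obtain ⟨r, hr⟩ := H _ _ _ (shortExact_pushout hS f)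
  exact ⟨pushout.inl _ _ ≫ r, by rw [pushout.condition_assoc, hr, Category.comp_id]⟩

theorem extVanishes_one_of_section {X Y : C}
    (H : ∀ {E : C} (i : Y ⟶ E) (p : E ⟶ X) (w : i ≫ p = 0),
      (ShortComplex.mk i p w).ShortExact → ∃ s : X ⟶ E, s ≫ p = 𝟙 X) :
    ExtVanishes X Y 1 := by
  refine extVanishes_one_of_retraction fun i p w hS => ?_
  obtain ⟨s, hs⟩ := H i p w hS
  have := hS.mono_f
  let σ := ShortComplex.Splitting.ofExactOfSection _ hS.exact s hs this
  exact ⟨σ.r, σ.f_r⟩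

/-- For an adjunction `F ⊣ G` with `F` preserving monomorphisms, `Ext¹(F X, Y) = 0` implies
`Ext¹(X, G Y) = 0`. -/
theorem ExtVanishes.of_leftAdjoint {D : Type*} [Category* D] [Abelian D] {F : C ⥤ D} {G : D ⥤ C}
    (adj : F ⊣ G) [F.PreservesMonomorphisms] {X : C} {Y : D}
    (h : ExtVanishes (F.obj X) Y 1) : ExtVanishes X (G.obj Y) 1 := by
  have : F.IsLeftAdjoint := adj.isLeftAdjoint
  have : PreservesColimitsOfSize.{0, 0} F := adj.leftAdjoint_preservesColimits
  refine extVanishes_one_of_retraction fun {E} i p w hS => ?_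
  have := hS.mono_f
  have := hS.epi_g
  have hF : ((ShortComplex.mk i p w).map F).ShortExact :=
    { exact := hS.exact.map_of_epi_of_preservesCokernel F inferInstance inferInstance
      mono_f := inferInstanceAs (Mono (F.map i))
      epi_g := inferInstanceAs (Epi (F.map p)) }
  -- The transpose of an extension of the counit along `F.map i` is the wanted retraction, by a
  -- triangle identity.
  obtain ⟨g, hg⟩ : ∃ g : F.obj E ⟶ Y, F.map i ≫ g = adj.counit.app Y :=
    ExtVanishes.exists_extension hF h (adj.counit.app Y)
  refine ⟨adj.homEquiv _ _ g, ?_⟩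
  rw [← adj.homEquiv_naturality_left, hg, Adjunction.homEquiv_unit,
    Adjunction.right_triangle_components]

/-- For an adjunction `F ⊣ G` with `G` preserving epimorphisms, `Ext¹(X, G Y) = 0` implies
`Ext¹(F X, Y) = 0`. -/
theorem ExtVanishes.of_rightAdjoint {D : Type*} [Category* D] [Abelian D] {F : D ⥤ C} {G : C ⥤ D}
    (adj : F ⊣ G) [G.PreservesEpimorphisms] {X : D} {Y : C}
    (h : ExtVanishes X (G.obj Y) 1) : ExtVanishes (F.obj X) Y 1 := by
  have : G.IsRightAdjoint := adj.isRightAdjoint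
  have : PreservesLimitsOfSize.{0, 0} G := adj.rightAdjoint_preservesLimits
  refine extVanishes_one_of_section fun {E} i p w hS => ?_
  have := hS.mono_f
  have := hS.epi_g
  have hG : ((ShortComplex.mk i p w).map G).ShortExact :=
    { exact := hS.exact.map_of_mono_of_preservesKernel G inferInstance inferInstance
      mono_f := inferInstanceAs (Mono (G.map i))
      epi_g := inferInstanceAs (Epi (G.map p)) }
  obtain ⟨g, hg⟩ : ∃ g : X ⟶ G.obj E, g ≫ G.map p = adj.unit.app X :=
    ExtVanishes.exists_lift hG h (adj.unit.app X)
  refine ⟨(adj.homEquiv _ _).symm g, ?_⟩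
  rw [← adj.homEquiv_naturality_right_symm, hg, Adjunction.homEquiv_counit,
    Adjunction.left_triangle_components]

theorem ExtVanishes.sigma {I : Type*} (X : I → C) [HasCoproduct X] {Y : C}
    (h : ∀ i, ExtVanishes (X i) Y 1) : ExtVanishes (∐ X) Y 1 := by
  refine extVanishes_one_of_section fun {E} i p w hS => ?_
  choose g hg using fun k => ExtVanishes.exists_lift hS (h k) (Sigma.ι X k)
  exact ⟨Sigma.desc g, Sigma.hom_ext _ _ fun k => by simpa using hg k⟩

theorem ExtVanishes.pi {I : Type*} {X : C} (Y : I → C) [HasProduct Y]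
    (h : ∀ i, ExtVanishes X (Y i) 1) : ExtVanishes X (∏ᶜ Y) 1 := by
  refine extVanishes_one_of_retraction fun {E} i p w hS => ?_
  choose g hg using fun k => ExtVanishes.exists_extension hS (h k) (Pi.π Y k)
  exact ⟨Pi.lift g, Pi.hom_ext _ _ fun k => by simpa using hg k⟩

theorem ExtVanishes.of_iso_left {X X' Y : C} (e : X ≅ X') (h : ExtVanishes X Y 1) :
    ExtVanishes X' Y 1 := by
  refine extVanishes_one_of_section fun {E} i p w hS => ?_
  obtain ⟨g, hg⟩ := ExtVanishes.exists_lift hS h e.hom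
  exact ⟨e.inv ≫ g, by rw [Category.assoc]; exact (Iso.inv_comp_eq e).2 (by simpa using hg)⟩

/-- If `Hom(X, f)` is surjective for an epimorphism `f`, then `Ext¹(X, Ker f)` embeds into
`Ext¹(X, Y)`. -/
theorem ExtVanishes.kernel {X Y Z : C} (f : Y ⟶ Z) (h : ExtVanishes X Y 1)
    (hf : ∀ g : X ⟶ Z, ∃ k : X ⟶ Y, k ≫ f = g) :
    ExtVanishes X (Limits.kernel f) 1 := by
  refine extVanishes_one_of_retraction fun {E} i p w hS => ?_
  obtain ⟨e, he⟩ := ExtVanishes.exists_extension hS h (kernel.ι f)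
  dsimp at e he
  have := hS.epi_g
  -- Here e extends the inclusion of the kernel to E. Its composite with f factors through X and
  -- lifts to k; subtracting `p ≫ k` moves e into the kernel.
  obtain ⟨k, hk⟩ := hf (hS.exact.desc (e ≫ f) (by
    dsimp; rw [reassoc_of% he, kernel.condition]))
  have hk' : p ≫ k ≫ f = e ≫ f := by
    rw [hk]
    exact hS.exact.g_desc _ _
  refine ⟨kernel.lift f (e - p ≫ k) (by simp [hk']), ?_⟩
  rw [← cancel_mono (kernel.ι f)]
  simp [he, reassoc_of% w]

end ExtVanishing

/-! ### Combinatorics of rooted quivers and paths -/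

theorem wellFounded_of_isRightRooted {Q : Type v} [Quiver.{v} Q] (hQ : IsRightRooted Q) :
    WellFounded fun j i : Q => Nonempty (i ⟶ j) := by
  have key : ∀ (α : Ordinal.{v}) (i : Q), i ∈ W Q α → Acc (fun j i : Q => Nonempty (i ⟶ j)) i := by
    intro α
    induction α using WellFoundedLT.induction with
    | ind α ih =>
      intro i hi
      rw [W] at hi
      rcases hi with ⟨β, rfl, h⟩ | ⟨-, β, hβ, h⟩
      · refine Acc.intro i fun j ⟨a⟩ => ?_
        by_contra hj
        refine h ⟨j, a, fun ⟨γ, hγ, hjγ⟩ => hj (ih γ (Order.lt_succ_of_le hγ) j hjγ)⟩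
      · exact ih β hβ i h
  obtain ⟨l, hl⟩ := hQ
  exact ⟨fun i => key l i (hl ▸ Set.mem_univ i)⟩

/-- A nontrivial path determines its first arrow. Paths grow at their end, so the induction strips
last arrows. -/
theorem toPath_comp_injective {Q : Type*} [Quiver Q] {i : Q} {j j' k : Q} (a : i ⟶ j) (a' : i ⟶ j')
    (p : Quiver.Path j k) (p' : Quiver.Path j' k) (h : a.toPath.comp p = a'.toPath.comp p') :
    (⟨⟨j, a⟩, p⟩ : Σ x : (Σ j : Q, i ⟶ j), Quiver.Path x.1 k) = ⟨⟨j', a'⟩, p'⟩ := by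
  induction p with
  | nil =>
    cases p' with
    | nil => cases h; rfl
    | cons p' b => simpa using congrArg Quiver.Path.length h
  | cons p b ih =>
    cases p' with
    | nil => simpa using congrArg Quiver.Path.length h
    | cons p' b' =>
      rw [Quiver.Path.comp_cons, Quiver.Path.comp_cons] at h
      obtain rfl := Quiver.Path.obj_eq_of_cons_eq_cons h
      cases ih _ (eq_of_heq (Quiver.Path.heq_of_cons_eq_cons h))
      cases Quiver.Path.hom_heq_of_cons_eq_cons h
      rfl

/-! ### Representations and their extensions by cocycles -/

section Representations

variable {Q : Type v} [Quiver.{v} Q] {M : Type u} [Category.{v} M]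

namespace QuiverRep

/-- The representation given by objects at the vertices and morphisms for the arrows. -/
abbrev mk (obj : Q → M) (map : ∀ i j : Q, (i ⟶ j) → (obj i ⟶ obj j)) : QuiverRep Q M :=
  Paths.lift { obj := obj, map := map _ _ }

theorem mk_arrow (obj : Q → M) (map : ∀ i j : Q, (i ⟶ j) → (obj i ⟶ obj j)) {i j : Q}
    (a : i ⟶ j) : (mk obj map).arrow a = map _ _ a :=
  Paths.lift_toPath _ a

/-- The morphism of representations given by a family of morphisms that commutes with all
arrows. -/
def homMk {X Y : QuiverRep Q M} (f : ∀ i : Paths Q, X.obj i ⟶ Y.obj i)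
    (h : ∀ {i j : Q} (a : i ⟶ j), X.arrow a ≫ f ((Paths.of Q).obj j) =
      f ((Paths.of Q).obj i) ≫ Y.arrow a) : X ⟶ Y where
  app := f
  naturality {i j} p := by
    revert p
    refine fun p => Paths.induction (fun {a b} p => X.map p ≫ f b = f a ≫ Y.map p) ?_ ?_ p
    · intro v
      rw [X.map_id, Y.map_id, Category.id_comp, Category.comp_id]
    · intro u v w p q hp
      rw [X.map_comp, Y.map_comp, Category.assoc, h q, reassoc_of% hp]

theorem arrow_naturality {X Y : QuiverRep Q M} (f : X ⟶ Y) {i j : Q} (a : i ⟶ j) :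
    X.arrow a ≫ f.app ((Paths.of Q).obj j) = f.app ((Paths.of Q).obj i) ≫ Y.arrow a :=
  f.naturality _

variable [Abelian M]

/-- The extension of `X` by `Y` given by a cocycle. -/
theorem exists_cocycleExtension (X Y : QuiverRep Q M)
    (c : ∀ i j : Q, (i ⟶ j) → (X.at' i ⟶ Y.at' j)) :
    ∃ (E : QuiverRep Q M) (inl : ∀ i, Y.obj i ⟶ E.obj i) (inr : ∀ i, X.obj i ⟶ E.obj i)
      (fst : ∀ i, E.obj i ⟶ Y.obj i) (snd : ∀ i, E.obj i ⟶ X.obj i),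
      (∀ i, inl i ≫ fst i = 𝟙 _) ∧ (∀ i, inr i ≫ snd i = 𝟙 _) ∧
      (∀ i, inl i ≫ snd i = 0) ∧ (∀ i, inr i ≫ fst i = 0) ∧
      (∀ i, fst i ≫ inl i + snd i ≫ inr i = 𝟙 _) ∧
      (∀ (i j : Q) (a : i ⟶ j), inl _ ≫ E.arrow a = Y.arrow a ≫ inl _) ∧
      (∀ (i j : Q) (a : i ⟶ j), inr _ ≫ E.arrow a = c _ _ a ≫ inl _ + X.arrow a ≫ inr _) := by
  refine ⟨mk (fun i => Y.at' i ⊞ X.at' i) fun i j a =>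
    biprod.desc (Y.arrow a ≫ biprod.inl) (c _ _ a ≫ biprod.inl + X.arrow a ≫ biprod.inr),
    fun i => (biprod.inl : Y.obj i ⟶ Y.obj i ⊞ X.obj i),
    fun i => (biprod.inr : X.obj i ⟶ Y.obj i ⊞ X.obj i),
    fun i => (biprod.fst : Y.obj i ⊞ X.obj i ⟶ Y.obj i),
    fun i => (biprod.snd : Y.obj i ⊞ X.obj i ⟶ X.obj i),
    fun i => biprod.inl_fst, fun i => biprod.inr_snd, fun i => biprod.inl_snd,
    fun i => biprod.inr_fst, fun i => biprod.total, fun i j a => ?_, fun i j a => ?_⟩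
  · rw [mk_arrow]
    exact biprod.inl_desc _ _
  · rw [mk_arrow]
    exact biprod.inr_desc _ _

/-- If `Ext¹(X, Y) = 0`, then every cocycle is a coboundary. -/
theorem exists_coboundary (X Y : QuiverRep Q M) (h : ExtVanishes X Y 1)
    (c : ∀ i j : Q, (i ⟶ j) → (X.at' i ⟶ Y.at' j)) :
    ∃ t : ∀ i, X.obj i ⟶ Y.obj i, ∀ {i j : Q} (a : i ⟶ j),
      c _ _ a = X.arrow a ≫ t _ - t _ ≫ Y.arrow a := by
  obtain ⟨E, inl, inr, fst, snd, hlf, hrs, hls, hrf, htot, hl, hr⟩ :=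
    exists_cocycleExtension X Y c
  have h₁ (i : Paths Q) : Mono (inl i) := mono_of_mono_fac (hlf i)
  have h₂ (i : Paths Q) : Epi (snd i) := epi_of_epi_fac (hrs i)
  have hEs {i j : Q} (a : i ⟶ j) : E.arrow a ≫ snd _ = snd _ ≫ X.arrow a := by
    rw [← Category.id_comp (E.arrow a), ← htot]
    simp [hl, hr, hls, hrs]
  let ι : Y ⟶ E := homMk inl fun {i j} a => (hl i j a).symm
  let π : E ⟶ X := homMk snd hEs
  have w : ι ≫ π = 0 := by
    ext i
    exact hls i
  have : ∀ i, Mono (ι.app i) := h₁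
  have : ∀ i, Epi (π.app i) := h₂
  have hm : Mono ι := NatTrans.mono_of_mono_app _
  have he : Epi π := NatTrans.epi_of_epi_app _
  have hS : (ShortComplex.mk ι π w).ShortExact := by
    refine { exact := ?_, mono_f := hm, epi_g := he }
    have hfac {Z : QuiverRep Q M} (k : Z ⟶ E) (hk : k ≫ π = 0) (i : Paths Q) :
        (k.app i ≫ fst i) ≫ inl i = k.app i := by
      have hk' : k.app i ≫ snd i = 0 := NatTrans.congr_app hk i
      rw [← Category.comp_id (k.app i), ← htot, Preadditive.comp_add, reassoc_of% hk']
      simp [hlf]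
    refine ShortComplex.exact_of_f_is_kernel _ (KernelFork.IsLimit.ofι' _ _ fun {Z} k hk =>
      ⟨homMk (fun i => k.app i ≫ fst i) fun {i j} a => ?_, ?_⟩)
    · rw [← cancel_mono (inl _), Category.assoc, hfac k hk, arrow_naturality, Category.assoc,
        ← hl, ← Category.assoc, hfac k hk]
    · ext i
      exact hfac k hk i
  obtain ⟨s, hs⟩ : ∃ s : X ⟶ E, s ≫ π = 𝟙 X := ExtVanishes.exists_lift hS h (𝟙 X)
  have hs' (i : Paths Q) : s.app i ≫ snd i = 𝟙 _ := NatTrans.congr_app hs i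
  refine ⟨fun i => s.app i ≫ fst i, fun {i j} a => ?_⟩
  have hsi (i : Paths Q) : s.app i = (s.app i ≫ fst i) ≫ inl i + inr i := by
    conv_lhs => rw [← Category.comp_id (s.app i), ← htot, Preadditive.comp_add,
      reassoc_of% hs' i]
    simp
  -- The Y-coordinate of naturality of the section is the coboundary equation.
  have h₃ := arrow_naturality s a =≫ fst _
  rw [Category.assoc] at h₃
  rw [h₃]
  nth_rw 1 [hsi]
  simp [hl, hr, hlf, hrf]

/-- The coproduct over proofs of j = i is X at i and zero elsewhere, without deciding equality of
vertices. -/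
theorem exists_stalk (i : Q) (X : M) :
    ∃ (S : QuiverRep Q M) (_ : ∀ j, S.obj j ≅ ∐ fun _ : PLift (j = (Paths.of Q).obj i) => X),
      ∀ (j k : Q) (a : j ⟶ k), S.arrow a = 0 :=
  ⟨mk (fun j => ∐ fun _ : PLift (j = i) => X) fun _ _ _ => 0, fun _ => Iso.refl _,
    fun _ _ a => mk_arrow _ _ a⟩

end QuiverRep

end Representations

/-! ### Adjoints of evaluation functors -/

section

variable {M : Type u} [Category.{v} M] [Abelian M]

instance evaluationLeftAdjoint_preservesMonomorphisms [HasCoproducts.{v} M] [AB4 M]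
    {J : Type v} [Category.{v} J] (c : J) :
    (evaluationLeftAdjoint M c).PreservesMonomorphisms where
  preserves {X Y} f hf := by
    have (t : J) : Mono (((evaluationLeftAdjoint M c).map f).app t) := by
      let α : Discrete.functor (fun _ : c ⟶ t => X) ⟶ Discrete.functor (fun _ : c ⟶ t => Y) :=
        Discrete.natTrans fun _ => f
      have : ∀ j, Mono (α.app j) := fun _ => hf
      have : Mono α := NatTrans.mono_of_mono_app _
      have hα : Mono (colim.map α) := inferInstance
      have e : ((evaluationLeftAdjoint M c).map f).app t = colim.map α := by
        rw [evaluationLeftAdjoint_map_app]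
        refine Sigma.hom_ext _ _ fun b => ?_
        rw [Sigma.ι_desc]
        exact (ι_colimMap α ⟨b⟩).symm
      exact e ▸ hα
    exact NatTrans.mono_of_mono_app _

instance evaluationRightAdjoint_preservesEpimorphisms [HasProducts.{v} M] [AB4Star M]
    {J : Type v} [Category.{v} J] (c : J) :
    (evaluationRightAdjoint M c).PreservesEpimorphisms where
  preserves {X Y} f hf := by
    have (t : J) : Epi (((evaluationRightAdjoint M c).map f).app t) := by
      let α : Discrete.functor (fun _ : t ⟶ c => X) ⟶ Discrete.functor (fun _ : t ⟶ c => Y) :=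
        Discrete.natTrans fun _ => f
      have : ∀ j, Epi (α.app j) := fun _ => hf
      have : Epi α := NatTrans.epi_of_epi_app _
      have hα : Epi (lim.map α) := inferInstance
      have e : ((evaluationRightAdjoint M c).map f).app t = lim.map α := by
        rw [evaluationRightAdjoint_map_app]
        refine Pi.hom_ext _ _ fun b => ?_
        rw [Pi.lift_π]
        exact (limMap_π α ⟨b⟩).symm
      exact e ▸ hα
    exact NatTrans.epi_of_epi_app _

/-- Left adjoints of evaluations preserve projectives. The coproduct of their values on covers of
the X(c) maps onto X, since its component at c is a factor of the cover of X(c). -/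
theorem functor_enoughProjectives [HasCoproducts.{v} M] [EnoughProjectives M]
    (J : Type v) [Category.{v} J] : EnoughProjectives (J ⥤ M) where
  presentation X := by
    let P (c : J) : J ⥤ M := (evaluationLeftAdjoint M c).obj (Projective.over (X.obj c))
    have (c : J) : Projective (P c) :=
      (evaluationAdjunctionRight M c).map_projective _ (Projective.projective_over _)
    let f (c : J) : P c ⟶ X := ((evaluationAdjunctionRight M c).homEquiv _ _).symm (Projective.π _)
    have hf (c : J) : Epi ((Sigma.desc f).app c) := by
      have h : (evaluationAdjunctionRight M c).homEquiv _ _ (f c) = Projective.π (X.obj c) :=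
        Equiv.apply_symm_apply _ _
      rw [Adjunction.homEquiv_unit, evaluation_obj_map, ← Sigma.ι_desc f c, NatTrans.comp_app,
        ← Category.assoc] at h
      exact epi_of_epi_fac h
    exact ⟨{ p := ∐ P, f := Sigma.desc f, epi := NatTrans.epi_of_epi_app _ }⟩

end

/-! ### The induced cotorsion pair -/

section Representations

variable {Q : Type v} [Quiver.{v} Q] {M : Type u} [Category.{v} M] [Abelian M]
  {A B : ObjectProperty M}

theorem IsCotorsionPair.extVanishes (h : IsCotorsionPair A B) {X Y : M} (hX : A X) (hY : B Y) :
    ExtVanishes X Y 1 := by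
  rw [h.eq_leftPerp] at hX
  exact hX Y hY

theorem IsCotorsionPair.left_of (h : IsCotorsionPair A B) {X : M}
    (hX : ∀ Y, B Y → ExtVanishes X Y 1) : A X := by
  rw [h.eq_leftPerp]
  exact hX

theorem IsCotorsionPair.right_of (h : IsCotorsionPair A B) {Y : M}
    (hY : ∀ X, A X → ExtVanishes X Y 1) : B Y := by
  rw [← h.rightPerp_eq]
  exact hY

/-- The value at j is the product of copies of N over the paths from j to i. Since nontrivial paths
split uniquely as an arrow and a path, ψ_j projects onto the factors of nontrivial paths; its kernel
is the factor of trivial paths. -/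
theorem psiClass_evaluationRightAdjoint [EnoughProjectives M] [HasProducts.{v} M]
    (h : IsCotorsionPair A B) (i : Paths Q) {N : M}
    (hN : B N) : PsiClass Q B ((evaluationRightAdjoint M i).obj N) := by
  intro j
  set Y : QuiverRep Q M := (evaluationRightAdjoint M i).obj N
  let Z : (Σ k : Q, j ⟶ k) → M := fun a => Y.at' a.1
  let π' (k : Q) (p : (Paths.of Q).obj k ⟶ i) : Y.at' k ⟶ N :=
    Pi.π (fun _ : (Paths.of Q).obj k ⟶ i => N) p
  have hπ' (k : Q) {T : M} (f g : T ⟶ Y.at' k) (hfg : ∀ p, f ≫ π' k p = g ≫ π' k p) : f = g :=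
    Pi.hom_ext _ _ hfg
  have hlift (k : Q) {T : M} (f : ((Paths.of Q).obj k ⟶ i) → (T ⟶ N)) :
      ∃ g : T ⟶ Y.at' k, ∀ p, g ≫ π' k p = f p :=
    ⟨Pi.lift f, fun p => Pi.lift_π _ p⟩
  have hψ (a : Σ k : Q, j ⟶ k) (p : (Paths.of Q).obj a.1 ⟶ i) :
      Y.psi j ≫ Pi.π Z a ≫ π' a.1 p = π' j ((Paths.of Q).map a.2 ≫ p) := by
    have h₁ : Y.psi j ≫ Pi.π Z a = Y.arrow a.2 := Pi.lift_π _ _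
    have h₂ : Y.arrow a.2 ≫ π' a.1 p = π' j ((Paths.of Q).map a.2 ≫ p) := Pi.lift_π _ _
    rw [reassoc_of% h₁, h₂]
  have hdec (p : (Paths.of Q).obj j ⟶ i) (hp : Quiver.Path.length p ≠ 0) :
      ∃ (a : Σ k : Q, j ⟶ k) (q : (Paths.of Q).obj a.1 ⟶ i), p = (Paths.of Q).map a.2 ≫ q := by
    obtain ⟨n, hn⟩ := Nat.exists_eq_succ_of_ne_zero hp
    obtain ⟨k, a, q, -, hq⟩ := Quiver.Path.eq_toPath_comp_of_length_eq_succ p hn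
    exact ⟨⟨k, a⟩, q, hq⟩
  have hlen {k : Q} (a : j ⟶ k) (q : (Paths.of Q).obj k ⟶ i) :
      Quiver.Path.length ((Paths.of Q).map a ≫ q) ≠ 0 := by
    have : Quiver.Path.length ((Paths.of Q).map a ≫ q) = 1 + Quiver.Path.length q :=
      Quiver.Path.length_comp a.toPath q
    lia
  refine ⟨?_, h.right_of fun X hX => ExtVanishes.pi _ fun _ => h.extVanishes hX hN, ?_⟩
  · let e (x : Σ a : (Σ k : Q, j ⟶ k), ((Paths.of Q).obj a.1 ⟶ i)) : (Paths.of Q).obj j ⟶ i :=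
      (Paths.of Q).map x.1.2 ≫ x.2
    have he : Function.Injective e := fun x y hxy => toPath_comp_injective _ _ _ _ hxy
    obtain ⟨s, hs⟩ := hlift j (Function.extend e
      (fun x => Pi.π Z x.1 ≫ π' x.1.1 x.2) fun _ => 0)
    refine epi_of_epi_fac (f := s) (h := 𝟙 (∏ᶜ Z)) (Pi.hom_ext _ _ fun a => hπ' _ _ _ fun p => ?_)
    rw [Category.assoc, Category.assoc, hψ, hs]
    exact (he.extend_apply _ _ ⟨a, p⟩).trans (by rw [Category.id_comp])
  · refine h.right_of fun X hX => extVanishes_one_of_retraction fun {E} ι p w hS => ?_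
    obtain ⟨r, hr⟩ : ∃ r : ((Paths.of Q).obj j ⟶ i) → (E ⟶ N), ∀ q,
        ι ≫ r q = kernel.ι (Y.psi j) ≫ π' j q := by
      choose r hr using fun q => ExtVanishes.exists_extension hS (h.extVanishes hX hN)
        (kernel.ι (Y.psi j) ≫ π' j q)
      exact ⟨r, hr⟩
    -- Coordinates at nontrivial paths are set to zero, which forces g into the kernel of ψ_j.
    obtain ⟨g, hg⟩ := hlift j fun q => if Quiver.Path.length q = 0 then r q else 0
    refine ⟨kernel.lift _ g (Pi.hom_ext _ _ fun a => hπ' _ _ _ fun q => ?_), ?_⟩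
    · refine (Category.assoc _ _ _).trans ((Category.assoc _ _ _).trans ?_)
      rw [hψ, hg, if_neg (hlen _ _), zero_comp, zero_comp]
    · rw [← cancel_mono (kernel.ι _), Category.assoc, kernel.lift_ι, Category.id_comp]
      refine hπ' _ _ _ fun q => ?_
      rw [Category.assoc, hg]
      split_ifs with hq
      · exact hr q
      · obtain ⟨a, q, rfl⟩ := hdec q hq
        rw [← hψ, kernel.condition_assoc, zero_comp, comp_zero]

theorem extVanishes_at' [EnoughProjectives M] [HasProducts.{v} M] [AB4Star M]
    (X : QuiverRep Q M) (i : Q) (N : M)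
    (h : ExtVanishes X ((evaluationRightAdjoint M ((Paths.of Q).obj i)).obj N) 1) :
    ExtVanishes (X.at' i) N 1 :=
  ExtVanishes.of_rightAdjoint (evaluationAdjunctionLeft M ((Paths.of Q).obj i)) h

section

variable [HasCoproducts.{v} M] [EnoughProjectives M]

theorem repClass_evaluationLeftAdjoint (h : IsCotorsionPair A B) (i : Paths Q) {X : M}
    (hX : A X) : RepClass Q A ((evaluationLeftAdjoint M i).obj X) := fun _ =>
  h.left_of fun _ hY => ExtVanishes.sigma _ fun _ => h.extVanishes hX hY

variable [HasProducts.{v} M]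

/-- If `Ext¹(S, Y) = 0` for the stalk representations `S` at `i` with value in a class of objects,
then `ψ_i` is surjective on morphisms from objects of this class. -/
theorem exists_lift_psi (h : IsCotorsionPair A B) {Y : QuiverRep Q M}
    (hY : rightPerp (RepClass Q A) Y) (i : Q) {X : M} (hX : A X)
    (g : X ⟶ ∏ᶜ (fun a : (Σ j : Q, i ⟶ j) => Y.at' a.1)) :
    ∃ k : X ⟶ Y.at' i, k ≫ Y.psi i = g := by
  obtain ⟨S, e, hS⟩ := QuiverRep.exists_stalk i X
  have hSA : RepClass Q A S := fun j => h.left_of fun Z hZ =>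
    ExtVanishes.of_iso_left (e j).symm (ExtVanishes.sigma _ fun _ => h.extVanishes hX hZ)
  obtain ⟨t, ht⟩ := QuiverRep.exists_coboundary S Y (hY S hSA) fun j k a =>
    (e _).hom ≫ Sigma.desc fun hj : PLift (j = i) =>
      g ≫ Pi.π (fun a : (Σ j : Q, i ⟶ j) => Y.at' a.1) ⟨k, hj.down ▸ a⟩
  let u : X ⟶ S.at' i :=
    Sigma.ι (fun _ : PLift (i = i) => X) ⟨rfl⟩ ≫ (e ((Paths.of Q).obj i)).inv
  let t' : S.at' i ⟶ Y.at' i := t _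
  -- Arrows of the stalk are zero, so the cocycle equals `-(t ≫ Y.arrow a)`; hence the sign.
  refine ⟨-(u ≫ t'), Pi.hom_ext _ _ fun ⟨k, a⟩ => ?_⟩
  have hta := ht a
  rw [hS, zero_comp, zero_sub, ← Iso.eq_inv_comp] at hta
  have key (m : PLift (i = i) → (X ⟶ Y.at' k))
      (z : (∐ fun _ : PLift (i = i) => X) ⟶ Y.at' k) (hm : Sigma.desc m = z) :
      m ⟨rfl⟩ = Sigma.ι (fun _ : PLift (i = i) => X) ⟨rfl⟩ ≫ z := by
    rw [← hm, Sigma.ι_desc]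
  have hg : g ≫ Pi.π (fun a : (Σ j : Q, i ⟶ j) => Y.at' a.1) ⟨k, a⟩ = u ≫ (-(t' ≫ Y.arrow a)) :=
    (key _ _ hta).trans (Category.assoc _ _ _).symm
  have hψ : Y.psi i ≫ Pi.π (fun a : (Σ j : Q, i ⟶ j) => Y.at' a.1) ⟨k, a⟩ = Y.arrow a :=
    Pi.lift_π _ _
  rw [hg, Category.assoc, hψ, Preadditive.neg_comp, Preadditive.comp_neg, Category.assoc]

theorem psiClass_of_rightPerp [AB4 M] (h : IsCotorsionPair A B) {Y : QuiverRep Q M}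
    (hY : rightPerp (RepClass Q A) Y) : PsiClass Q B Y := by
  intro i
  have hYi : B (Y.at' i) := h.right_of fun X hX =>
    ExtVanishes.of_leftAdjoint (evaluationAdjunctionRight M ((Paths.of Q).obj i))
      (hY _ (repClass_evaluationLeftAdjoint h _ hX))
  -- Projectives lie in A, so a projective cover of the product lifts through ψ_i, which is
  -- therefore epi.
  obtain ⟨k, hk⟩ := exists_lift_psi h hY i
    (h.left_of fun Z _ => extVanishes_succ_of_projective _ Z 0) (Projective.π _)
  exact ⟨epi_of_epi_fac hk, hYi,
    h.right_of fun X hX => ExtVanishes.kernel _ (h.extVanishes hX hYi) (exists_lift_psi h hY i hX)⟩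

theorem extVanishes_of_psiClass (hQ : IsRightRooted Q) (h : IsCotorsionPair A B)
    {X Y : QuiverRep Q M} (hX : RepClass Q A X) (hY : PsiClass Q B Y) : ExtVanishes X Y 1 := by
  have : EnoughProjectives (QuiverRep Q M) := functor_enoughProjectives (Paths Q)
  refine extVanishes_one_of_section fun {E} ι p w hS => ?_
  have hSi (i : Paths Q) : (ShortComplex.mk (ι.app i) (p.app i)
      (NatTrans.congr_app w i)).ShortExact :=
    hS.map_of_exact ((evaluation _ M).obj i)
  have step (i : Q) (s : ∀ j : Q, Nonempty (i ⟶ j) →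
      {s : X.at' j ⟶ E.at' j // s ≫ p.app ((Paths.of Q).obj j) = 𝟙 _}) :
      ∃ t : X.at' i ⟶ E.at' i, t ≫ p.app ((Paths.of Q).obj i) = 𝟙 _ ∧
        ∀ (j : Q) (a : i ⟶ j), X.arrow a ≫ (s j ⟨a⟩).1 = t ≫ E.arrow a := by
    obtain ⟨hψ, hYi, hK⟩ := hY i
    obtain ⟨t, ht⟩ : ∃ t : X.at' i ⟶ E.at' i, t ≫ p.app ((Paths.of Q).obj i) = 𝟙 _ :=
      ExtVanishes.exists_lift (hSi _) (h.extVanishes (hX i) hYi) (𝟙 _)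
    -- The defect of t along a vanishes in X, so it comes from Y.
    have hd (a : Σ j : Q, i ⟶ j) : ∃ d : X.at' i ⟶ Y.at' a.1,
        d ≫ ι.app ((Paths.of Q).obj a.1) = t ≫ E.arrow a.2 - X.arrow a.2 ≫ (s a.1 ⟨a.2⟩).1 := by
      have := (hSi ((Paths.of Q).obj a.1)).mono_f
      refine ⟨_, (hSi ((Paths.of Q).obj a.1)).exact.lift_f _ ?_⟩
      rw [Preadditive.sub_comp, Category.assoc, Category.assoc, (s a.1 ⟨a.2⟩).2,
        QuiverRep.arrow_naturality, reassoc_of% ht, Category.comp_id, sub_self]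
    choose d hd using hd
    obtain ⟨k, hk⟩ : ∃ k : X.at' i ⟶ Y.at' i, k ≫ Y.psi i = Pi.lift d :=
      ExtVanishes.exists_lift (shortExact_kernel (Y.psi i)) (h.extVanishes (hX i) hK) (Pi.lift d)
    refine ⟨t - k ≫ ι.app _, ?_, fun j a => ?_⟩
    · have hw : ι.app ((Paths.of Q).obj i) ≫ p.app ((Paths.of Q).obj i) = 0 :=
        NatTrans.congr_app w _
      rw [Preadditive.sub_comp, ht, Category.assoc, hw, comp_zero, sub_zero]
    · have hka : k ≫ Y.arrow a = d ⟨j, a⟩ := by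
        have := hk =≫ Pi.π (fun a : (Σ j : Q, i ⟶ j) => Y.at' a.1) ⟨j, a⟩
        simpa [QuiverRep.psi] using this
      rw [Preadditive.sub_comp, Category.assoc, ← QuiverRep.arrow_naturality, reassoc_of% hka,
        hd ⟨j, a⟩, sub_sub_cancel]
  have hwf := wellFounded_of_isRightRooted hQ
  let F (i : Q) (s : ∀ j : Q, Nonempty (i ⟶ j) →
      {s : X.at' j ⟶ E.at' j // s ≫ p.app ((Paths.of Q).obj j) = 𝟙 _}) :
      {s : X.at' i ⟶ E.at' i // s ≫ p.app ((Paths.of Q).obj i) = 𝟙 _} :=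
    ⟨(step i s).choose, (step i s).choose_spec.1⟩
  let s (i : Q) : {s : X.at' i ⟶ E.at' i // s ≫ p.app ((Paths.of Q).obj i) = 𝟙 _} := hwf.fix F i
  have hs {i j : Q} (a : i ⟶ j) : X.arrow a ≫ (s j).1 = (s i).1 ≫ E.arrow a := by
    have : s i = F i fun j _ => s j := hwf.fix_eq F i
    rw [this]
    exact (step i fun j _ => s j).choose_spec.2 j a
  refine ⟨QuiverRep.homMk (fun i => (s i).1) hs, ?_⟩
  ext i
  exact (s i).2

theorem rightPerp_repClass [AB4 M] (hQ : IsRightRooted Q) (h : IsCotorsionPair A B) :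
    rightPerp (RepClass Q A) = PsiClass Q B :=
  funext fun _ => propext ⟨psiClass_of_rightPerp h,
    fun hY _ hX => extVanishes_of_psiClass hQ h hX hY⟩

variable [AB4Star M]

theorem isCotorsionPair_repClass_psiClass [AB4 M] (hQ : IsRightRooted Q)
    (h : IsCotorsionPair A B) : IsCotorsionPair (RepClass Q A) (PsiClass Q B) where
  rightPerp_eq := rightPerp_repClass hQ h
  eq_leftPerp := funext fun X => propext
    ⟨fun hX _ hY => extVanishes_of_psiClass hQ h hX hY, fun hX i => h.left_of fun N hN =>
      extVanishes_at' X i N (hX _ (psiClass_evaluationRightAdjoint h _ hN))⟩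

theorem isHereditary_repClass_psiClass [AB4 M] (hQ : IsRightRooted Q)
    (h : IsCotorsionPair A B) (hh : IsHereditary A B) :
    IsHereditary (RepClass Q A) (PsiClass Q B) := by
  have : EnoughProjectives (QuiverRep Q M) := functor_enoughProjectives (Paths Q)
  have h' := isCotorsionPair_repClass_psiClass hQ h
  suffices ∀ (n : ℕ) (X Y : QuiverRep Q M), RepClass Q A X → PsiClass Q B Y →
      ExtVanishes X Y (n + 1) by
    intro X Y hX hY n hn
    obtain ⟨n, rfl⟩ := Nat.exists_eq_add_of_le' hn
    exact this n X Y hX hY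
  intro n
  induction n with
  | zero => exact fun X Y hX hY => h'.extVanishes hX hY
  | succ n ih =>
    intro X Y hX hY
    have hS := shortExact_kernel (Projective.π X)
    refine ExtVanishes.of_shortExact_right hS (ih _ _ (fun i => h.left_of fun N hN => ?_) hY)
      (extVanishes_succ_of_projective (Projective.over X) Y (n + 1))
    have hP : RepClass Q A (Projective.over X) :=
      h'.left_of fun Z _ => extVanishes_succ_of_projective (Projective.over X) Z 0
    -- The kernel K of the projective cover P stays in `RepClass Q A`: Ext¹(K(i), N) lies between
    -- Ext¹(P(i), N) and Ext²(X(i), N), and heredity kills the latter.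
    exact ExtVanishes.of_shortExact_left
      (hS.map_of_exact ((evaluation _ M).obj ((Paths.of Q).obj i)))
      (h.extVanishes (hP i) hN) (hh _ _ (hX i) hN 2 one_le_two)

theorem isCogeneratedBySet_repClass_psiClass [AB4 M] (hQ : IsRightRooted Q)
    (h : IsCotorsionPair A B) (hc : IsCogeneratedBySet A B) :
    IsCogeneratedBySet (RepClass Q A) (PsiClass Q B) := by
  obtain ⟨S, hS, hA, hB⟩ := hc
  have h' := isCotorsionPair_repClass_psiClass hQ h
  -- The cogenerating set consists of the G_i(N) for vertices i and N in S; it is small as an image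
  -- of Q × S.
  let T : ObjectProperty (QuiverRep Q M) := fun Z => ∃ (i : Q) (N : Subtype S),
    Z = (evaluationRightAdjoint M ((Paths.of Q).obj i)).obj N.1
  have hT : RepClass Q A = leftPerp T := by
    refine funext fun X => propext ⟨fun hX Z ⟨i, N, hZ⟩ => ?_, fun hX i => ?_⟩
    · subst hZ
      refine h'.extVanishes hX (psiClass_evaluationRightAdjoint h _ ?_)
      rw [hB]
      exact fun W hW => hW _ N.2
    · rw [hA]
      exact fun N hN => extVanishes_at' X i N (hX _ ⟨i, ⟨N, hN⟩, rfl⟩)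
  refine ⟨T, ?_, hT, ?_⟩
  · have : Small.{v} (Subtype S) := hS
    let f (x : Q × Subtype S) : Subtype T := ⟨_, x.1, x.2, rfl⟩
    exact small_of_surjective (f := f) fun ⟨Z, i, N, hZ⟩ => ⟨(i, N), Subtype.ext hZ.symm⟩
  · rw [← hT, h'.rightPerp_eq]

end

end Representations

end CotorsionQuiver

theorem theoremB {Q : Type v} [Quiver.{v} Q] (hQ : CotorsionQuiver.IsRightRooted Q)
    {M : Type u} [Category.{v} M] [Abelian M]
    [HasCoproducts.{v} M] [AB4 M] [HasProducts.{v} M] [AB4Star M]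
    [EnoughProjectives M] [EnoughInjectives M]
    (A B : ObjectProperty M) (hAB : CotorsionQuiver.IsCotorsionPair A B) :
    CotorsionQuiver.IsCotorsionPair
        (CotorsionQuiver.RepClass Q A) (CotorsionQuiver.PsiClass Q B) ∧
      (CotorsionQuiver.IsHereditary A B →
        CotorsionQuiver.IsHereditary
          (CotorsionQuiver.RepClass Q A) (CotorsionQuiver.PsiClass Q B)) ∧
      (CotorsionQuiver.IsCogeneratedBySet A B →
        CotorsionQuiver.IsCogeneratedBySet
          (CotorsionQuiver.RepClass Q A) (CotorsionQuiver.PsiClass Q B)) :=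
  ⟨CotorsionQuiver.isCotorsionPair_repClass_psiClass hQ hAB,
    CotorsionQuiver.isHereditary_repClass_psiClass hQ hAB,
    CotorsionQuiver.isCogeneratedBySet_repClass_psiClass hQ hAB⟩
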